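/- Let $a,b,d\in\mathbb{R}$ with $a>0$, $b\ge 0$ and $d<0$, and let $W_0(x)=1$, $W_1(x)=x$ and $W_n(x)=(ax+b)W_{n-1}(x)+d\,W_{n-2}(x)$ for $n\ge 2$. Then, for every $n\ge 0$, the polynomial $W_n(x)$ has degree $n$, and all its roots are real and distinct. Write $R_n=\{\xi_{n,1}<\xi_{n,2}<\cdots<\xi_{n,n}\}$ for the set of roots of $W_n(x)$, and define $$x_\Delta^{\pm}=\frac{-b\pm 2\sqrt{-d}}{a},\qquad b_0=|a-2|\sqrt{-d},\qquad x_g^{\pm}=\begin{cases}\dfrac{-b\pm\sqrt{b^2-4d(a-1)}}{2(a-1)},&\text{if } a\ne 1;\\[2ex] -\dfrac{d}{b},&\text{if } a=1\text{ and } b\ne 0.\end{cases}$$ For a sequence of real numbers, $u_n\searrow u$ (respectively $u_n\nearrow u$) means that $u_n$ is strictly decreasing (respectively strictly increasing) and converges to $u$ as $n\to\infty$; the sequences $\xi_{n,j}$ and $\xi_{n,n+1-j}$ are indexed by $n\ge j$. For every $n\ge 0$ the set $R_{n+1}$ interlaces $R_n$, that is, $$\xi_{n+1,1}<\xi_{n,1}<\xi_{n+1,2}<\xi_{n,2}<\cdots<\xi_{n+1,n}<\xi_{n,n}<\xi_{n+1,n+1}$$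 (for $n=0$: a singleton interlaces the empty set), and for every $j\ge 2$, $$\xi_{n,j}\searrow x_\Delta^-\quad\text{and}\quad \xi_{n,n+1-j}\nearrow x_\Delta^+ .$$ Moreover: (i) If $a\le 2$ and $b\le b_0$, then $\xi_{n,1}\searrow x_\Delta^-$ and $\xi_{n,n}\nearrow x_\Delta^+$. (ii) If $a>2$ and $b<b_0$, then $x_g^\pm$ are well-defined real numbers, $\xi_{n,1}\searrow x_g^-$ and $\xi_{n,n}\nearrow x_g^+$. (iii) Otherwise, $x_g^\pm$ are well-defined real numbers, $\xi_{n,1}\searrow x_\Delta^-$ and $\xi_{n,n}\nearrow x_g^+$. -/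

import Mathlib

open Polynomial Filter Topology

noncomputable section

/-- The normalized sequence `W_0 = 1`, `W_1 = x`, `W_n = (a x + b) W_{n-1} + d W_{n-2}`. -/
def W (a b d : ℝ) : ℕ → ℝ[X]
  | 0 => 1
  | 1 => X
  | n + 2 => (C a * X + C b) * W a b d (n + 1) + C d * W a b d n

/-- All (complex) roots of the nonzero polynomial `p` are real, and they are pairwise distinct,
i.e. there are no repetitions in the multiset of roots. -/
def DistinctRealRooted (p : ℝ[X]) : Prop :=
  p ≠ 0 ∧ (∀ z ∈ p.aroots ℂ, z.im = 0) ∧ (p.aroots ℂ).Nodup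

/-- The set of (real) roots of a real polynomial. -/
def zeroSet (p : ℝ[X]) : Set ℝ := {x | p.IsRoot x}

/-- `X = {x_1, …, x_{m+1}}` interlaces `Y = {y_1, …, y_m}`:
`x_1 < y_1 < x_2 < y_2 < ⋯ < x_m < y_m < x_{m+1}`. For `m = 0`, a singleton interlaces the
empty set. -/
def Interlaces (X Y : Set ℝ) : Prop :=
  ∃ (m : ℕ) (x y : ℕ → ℝ), X = x '' Set.Icc 1 (m + 1) ∧ Y = y '' Set.Icc 1 m ∧
    ∀ i ∈ Set.Icc 1 m, x i < y i ∧ y i < x (i + 1)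

/-- `S = {s 1, …, s n}` with `s 1 < s 2 < ⋯ < s n`. -/
def IsIncreasingList (S : Set ℝ) (n : ℕ) (s : ℕ → ℝ) : Prop :=
  StrictMonoOn s (Set.Icc 1 n) ∧ s '' Set.Icc 1 n = S

/-- The sequence `u n`, `n ≥ n₀`, is strictly decreasing and converges to `x`. -/
def DecreasesTo (n₀ : ℕ) (u : ℕ → ℝ) (x : ℝ) : Prop :=
  StrictAntiOn u (Set.Ici n₀) ∧ Tendsto u atTop (𝓝 x)

/-- The sequence `u n`, `n ≥ n₀`, is strictly increasing and converges to `x`. -/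
def IncreasesTo (n₀ : ℕ) (u : ℕ → ℝ) (x : ℝ) : Prop :=
  StrictMonoOn u (Set.Ici n₀) ∧ Tendsto u atTop (𝓝 x)

/-- `x_Δ^-` -/
def xDeltaMinus (a b d : ℝ) : ℝ := (-b - 2 * √(-d)) / a

/-- `x_Δ^+` -/
def xDeltaPlus (a b d : ℝ) : ℝ := (-b + 2 * √(-d)) / a

/-- `b_0` -/
def bZero (a d : ℝ) : ℝ := |a - 2| * √(-d)

open Classical in
/-- `x_g^-`; meaningful under `XgDefined a b d`. -/
def xgMinus (a b d : ℝ) : ℝ :=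
  if a = 1 then -d / b else (-b - √(b ^ 2 - 4 * d * (a - 1))) / (2 * (a - 1))

open Classical in
/-- `x_g^+`; meaningful under `XgDefined a b d`. -/
def xgPlus (a b d : ℝ) : ℝ :=
  if a = 1 then -d / b else (-b + √(b ^ 2 - 4 * d * (a - 1))) / (2 * (a - 1))

/-- The formulas for `x_g^±` involve no division by zero and no square root of a negative number,
so that `x_g^±` are defined and real. -/
def XgDefined (a b d : ℝ) : Prop :=
  (a ≠ 1 ∧ 0 ≤ b ^ 2 - 4 * d * (a - 1)) ∨ (a = 1 ∧ b ≠ 0)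

end

/-!
Write `s = √(-d)` and `ax + b = 2s cos θ`. Then
`sin θ * W_{n+1}(x) = s ^ n * (x * sin ((n + 1)θ) - s * sin (nθ))` (`sin_mul_eval_W`), so at the
points `cosPoint a b d n k` with `θ = kπ/n`, `0 < k < n`, the value of `W_n` is `(-1) ^ k * s ^ n`.

These `n - 1` points are completed by two end points. On the right, `rightEnd` is `x_Δ^+` if
`b ≤ (2 - a)s`; there `W_n` is positive by an explicit formula. Otherwise `rightEnd` is `x_g^+`,
which then is a solution `t = x` in `(0, s)` of the characteristic equation `t² = (ax + b)t + d`,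
so that `W_n(x_g^+) = (x_g^+) ^ n > 0`. The left end point comes from the symmetry
`(b, x) ↦ (-b, -x)`; this is why the lemmas about the right end impose no sign on `b`. The three
cases of the theorem say which alternative holds at each end.

So `W_n` alternates in sign at `n + 1` increasing points (`eval_W_samplePoint`). This gives `n`
simple real roots, one in each gap (`root_mem_gap`). All but the extreme roots are thereby squeezed
between cosine points which, for a fixed rank counted from either end, tend to `x_Δ^±`; the
extreme roots lie between such a point and an end point, which settles them too when the end point
is `x_Δ^±`. Interlacing, and with it the strict monotonicity of the root sequences, follows by the
classical Sturm induction (`roots_interlace`).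

For the largest root when the end point is `x_g^+`, it remains to see that arbitrarily close to
`x_g^+` on the left some `W_n` is nonpositive (`exists_eval_W_nonpos`). Take `x` such that the
characteristic equation at `x` has roots `l ≤ m` with `x < l`, where `l` is slightly above `x_g^+`.
Then `W_{n+1}(x) - l W_n(x) = m ^ n * (x - l)`, and `W_n(x) / l ^ n` decreases at least linearly.
-/

/-! ### Increasing enumerations of root sets -/

lemma IsIncreasingList.mem {S : Set ℝ} {n : ℕ} {s : ℕ → ℝ} (h : IsIncreasingList S n s) {i : ℕ}
    (h1 : 1 ≤ i) (hn : i ≤ n) : s i ∈ S :=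
  h.2 ▸ Set.mem_image_of_mem s ⟨h1, hn⟩

/-- The increasing enumeration of a set is unique: the index map between two of them is a strictly
increasing self-map of `{1, …, n}`, hence the identity. -/
lemma IsIncreasingList.unique {S : Set ℝ} {n : ℕ} {s t : ℕ → ℝ} (hs : IsIncreasingList S n s)
    (ht : IsIncreasingList S n t) : Set.EqOn s t (Set.Icc 1 n) := by
  have key : ∀ {u v : ℕ → ℝ}, IsIncreasingList S n u → IsIncreasingList S n v →
      ∀ i, 1 ≤ i → i ≤ n → v i ≤ u i := by
    intro u v hu hv i h1 hi
    have hex : ∀ k ∈ Set.Icc 1 n, ∃ l ∈ Set.Icc 1 n, v l = u k := fun k hk => by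
      have : u k ∈ v '' Set.Icc 1 n := hv.2 ▸ hu.mem hk.1 hk.2
      exact this
    choose! σ hσ hσv using hex
    have hmono : ∀ k, 1 ≤ k → k + 1 ≤ n → σ k < σ (k + 1) := fun k hk hkn => by
      have hk1 : k ∈ Set.Icc 1 n := ⟨hk, by omega⟩
      have hk2 : k + 1 ∈ Set.Icc 1 n := ⟨by omega, hkn⟩
      rw [← hv.1.lt_iff_lt (hσ k hk1) (hσ _ hk2), hσv k hk1, hσv _ hk2]
      exact hu.1 hk1 hk2 (Nat.lt_succ_self k)
    have hle : ∀ k, 1 ≤ k → k ≤ n → k ≤ σ k := by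
      intro k hk
      induction k, hk using Nat.le_induction with
      | base => exact fun h => (hσ 1 ⟨le_rfl, h⟩).1
      | succ k hk ih => exact fun h => (ih (by omega)).trans_lt (hmono k hk h)
    have hi' : i ∈ Set.Icc 1 n := ⟨h1, hi⟩
    rw [← hσv i hi']
    exact (hv.1.le_iff_le hi' (hσ i hi')).2 (hle i h1 hi)
  exact fun i hi => le_antisymm (key ht hs i hi.1 hi.2) (key hs ht i hi.1 hi.2)

lemma IsIncreasingList.roots_eq {p : ℝ[X]} {n : ℕ} {s : ℕ → ℝ} (hp : p ≠ 0)
    (hdeg : p.natDegree = n) (h : IsIncreasingList (zeroSet p) n s) :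
    p.roots = (Finset.Icc 1 n).val.map s := by
  symm
  apply Multiset.eq_of_le_of_card_le
  · rw [Multiset.le_iff_subset]
    · intro x hx
      obtain ⟨i, hi, rfl⟩ := Multiset.mem_map.1 hx
      have hi' : 1 ≤ i ∧ i ≤ n := by simpa using hi
      exact (mem_roots hp).2 (h.mem hi'.1 hi'.2)
    · refine Multiset.Nodup.map_on ?_ (Finset.Icc 1 n).nodup
      intro i hi j hj hij
      exact h.1.injOn (Finset.mem_Icc.1 hi) (Finset.mem_Icc.1 hj) hij
  · simpa [hdeg] using p.card_roots'

lemma IsIncreasingList.eq_prod {p : ℝ[X]} {n : ℕ} {s : ℕ → ℝ} (hp : p ≠ 0)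
    (hdeg : p.natDegree = n) (h : IsIncreasingList (zeroSet p) n s) :
    p = C p.leadingCoeff * ∏ i ∈ Finset.Icc 1 n, (X - C (s i)) := by
  have hr := h.roots_eq hp hdeg
  have hc : Multiset.card p.roots = p.natDegree := by simp [hr, hdeg]
  conv_lhs => rw [← C_leadingCoeff_mul_prod_multiset_X_sub_C hc, hr, Multiset.map_map]
  rfl

lemma IsIncreasingList.distinctRealRooted {p : ℝ[X]} {n : ℕ} {s : ℕ → ℝ} (hp : p ≠ 0)
    (hdeg : p.natDegree = n) (h : IsIncreasingList (zeroSet p) n s) : DistinctRealRooted p := by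
  have hroots : p.aroots ℂ = (Finset.Icc 1 n).val.map (fun i => (s i : ℂ)) := by
    have hmap : p.map (algebraMap ℝ ℂ) = C (p.leadingCoeff : ℂ) *
        (((Finset.Icc 1 n).val.map (fun i => (s i : ℂ))).map (fun z => X - C z)).prod := by
      conv_lhs => rw [h.eq_prod hp hdeg]
      simp [Polynomial.map_prod, Multiset.map_map]
    rw [aroots_def, hmap, roots_C_mul _ (by simpa using hp), roots_multiset_prod_X_sub_C]
  refine ⟨hp, fun z hz => ?_, ?_⟩
  · rw [hroots] at hz
    obtain ⟨i, -, rfl⟩ := Multiset.mem_map.1 hz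
    simp
  · rw [hroots]
    refine Multiset.Nodup.map_on ?_ (Finset.Icc 1 n).nodup
    intro i hi j hj hij
    exact h.1.injOn (Finset.mem_Icc.1 hi) (Finset.mem_Icc.1 hj) (by exact_mod_cast hij)

/-- The sign of `p` to the right of exactly `i` of its `n` simple roots is `(-1) ^ (n - i)`. -/
lemma IsIncreasingList.sign_eval {p : ℝ[X]} {n : ℕ} {s : ℕ → ℝ} (hlc : 0 < p.leadingCoeff)
    (hdeg : p.natDegree = n) (h : IsIncreasingList (zeroSet p) n s) {i : ℕ} (hi : i ≤ n) {x : ℝ}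
    (hlt : ∀ k, 1 ≤ k → k ≤ i → s k < x) (hgt : ∀ k, i < k → k ≤ n → x < s k) :
    0 < (-1) ^ (n - i) * p.eval x := by
  have hp : p ≠ 0 := by rintro rfl; simp at hlc
  have key : ∀ m, i ≤ m → m ≤ n → 0 < (-1) ^ (m - i) * ∏ k ∈ Finset.Icc 1 m, (x - s k) := by
    intro m hm
    induction m, hm using Nat.le_induction with
    | base =>
      intro _
      have : 0 < ∏ k ∈ Finset.Icc 1 i, (x - s k) := Finset.prod_pos fun k hk => by
        have hk := Finset.mem_Icc.1 hk
        linarith [hlt k hk.1 hk.2]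
      simpa using this
    | succ m hm ih =>
      intro hmn
      rw [Finset.prod_Icc_succ_top (by omega), Nat.succ_sub hm, pow_succ]
      nlinarith [mul_pos (ih (by omega)) (sub_pos.2 (hgt (m + 1) (by omega) hmn))]
  rw [h.eq_prod hp hdeg, eval_mul, eval_C, eval_prod, mul_left_comm]
  simpa using mul_pos hlc (key n hi le_rfl)

/-- If a polynomial of degree `n` alternates in sign at `n + 1` increasing points, then it has
exactly one root in each of the `n` gaps, and no others. -/
lemma exists_isIncreasingList_of_alternating {p : ℝ[X]} {n : ℕ} (hp : p ≠ 0)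
    (hdeg : p.natDegree = n) {y : ℕ → ℝ} (hy : ∀ i < n, y i < y (i + 1))
    (hs : ∀ i ≤ n, 0 < (-1) ^ (n - i) * p.eval (y i)) :
    ∃ x : ℕ → ℝ, IsIncreasingList (zeroSet p) n x ∧
      ∀ i < n, y i < x (i + 1) ∧ x (i + 1) < y (i + 1) := by
  have hex : ∀ i, ∃ x, i < n → (y i < x ∧ x < y (i + 1)) ∧ p.eval x = 0 := by
    intro i
    by_cases hi : i < n
    swap
    · exact ⟨0, fun h => absurd h hi⟩
    have h1 := hs i hi.le
    have h2 := hs (i + 1) hi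
    rw [show n - i = n - (i + 1) + 1 by omega, pow_succ] at h1
    have hcont : ContinuousOn (fun x => (-1) ^ (n - (i + 1)) * p.eval x)
        (Set.Icc (y i) (y (i + 1))) := by fun_prop
    obtain ⟨x, hx, hx0⟩ := intermediate_value_Ioo (hy i hi).le hcont
      (show (0 : ℝ) ∈ Set.Ioo _ _ from ⟨by linarith, h2⟩)
    exact ⟨x, fun _ => ⟨hx, by simpa using hx0⟩⟩
  choose z hz using hex
  have hmono : StrictMonoOn (fun i => z (i - 1)) (Set.Icc 1 n) := by
    refine strictMonoOn_of_lt_add_one Set.ordConnected_Icc fun k _ hk hk' => ?_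
    obtain ⟨k, rfl⟩ : ∃ l, k = l + 1 := ⟨k - 1, by have := hk.1; omega⟩
    have := hk'.2
    exact (hz k (by omega)).1.2.trans (hz (k + 1) (by omega)).1.1
  refine ⟨fun i => z (i - 1), ⟨hmono, ?_⟩, fun i hi => (hz i hi).1⟩
  have hsub : (Finset.Icc 1 n).image (fun i => z (i - 1)) ⊆ p.roots.toFinset := by
    intro x hx
    obtain ⟨i, hi, rfl⟩ := Finset.mem_image.1 hx
    have := Finset.mem_Icc.1 hi
    simpa [hp] using (hz (i - 1) (by omega)).2
  have heq := Finset.eq_of_subset_of_card_le hsub (by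
    rw [Finset.card_image_of_injOn (by simpa using hmono.injOn), Nat.card_Icc, Nat.add_sub_cancel]
    exact (Multiset.toFinset_card_le _).trans (p.card_roots'.trans hdeg.le))
  ext x
  have hx := Finset.ext_iff.1 heq x
  simpa [hp, zeroSet] using hx

/-- Alternating signs locate the roots of a given increasing enumeration. -/
lemma IsIncreasingList.mem_gap {p : ℝ[X]} {n : ℕ} {s : ℕ → ℝ} (hp : p ≠ 0)
    (hdeg : p.natDegree = n) (h : IsIncreasingList (zeroSet p) n s) {y : ℕ → ℝ}
    (hy : ∀ i < n, y i < y (i + 1)) (hs : ∀ i ≤ n, 0 < (-1) ^ (n - i) * p.eval (y i)) :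
    ∀ i < n, y i < s (i + 1) ∧ s (i + 1) < y (i + 1) := by
  obtain ⟨x, hx, hloc⟩ := exists_isIncreasingList_of_alternating hp hdeg hy hs
  intro i hi
  rw [h.unique hx ⟨by omega, hi⟩]
  exact hloc i hi

/-! ### The recurrence -/

lemma W_add_two (a b d : ℝ) (n : ℕ) :
    W a b d (n + 2) = (C a * X + C b) * W a b d (n + 1) + C d * W a b d n := rfl

lemma eval_W_zero (a b d x : ℝ) : (W a b d 0).eval x = 1 := by simp [W]

lemma eval_W_one (a b d x : ℝ) : (W a b d 1).eval x = x := by simp [W]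

lemma eval_W_add_two (a b d x : ℝ) (n : ℕ) : (W a b d (n + 2)).eval x =
    (a * x + b) * (W a b d (n + 1)).eval x + d * (W a b d n).eval x := by
  simp [W_add_two]

/-- Reflection `x ↦ -x` amounts to `b ↦ -b`. -/
lemma eval_W_neg (a b d x : ℝ) (n : ℕ) :
    (W a (-b) d n).eval x = (-1) ^ n * (W a b d n).eval (-x) := by
  induction n using Nat.twoStepInduction with
  | zero => simp [eval_W_zero]
  | one => simp [eval_W_one]
  | more n ih1 ih2 =>
    rw [eval_W_add_two, eval_W_add_two, ih1, ih2]
    ring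

/-- The truncated exponent `n - 1` makes the formula right also for `W_0 = 1`. -/
lemma natDegree_W_and_leadingCoeff {a : ℝ} (ha : 0 < a) (b d : ℝ) (n : ℕ) :
    (W a b d n).natDegree = n ∧ (W a b d n).leadingCoeff = a ^ (n - 1) := by
  induction n using Nat.twoStepInduction with
  | zero => simp [W]
  | one => simp [W]
  | more n ih1 ih2 =>
    have hl : (C a * X + C b).leadingCoeff = a := leadingCoeff_linear ha.ne'
    have hn : (C a * X + C b).natDegree = 1 := natDegree_linear ha.ne'
    have hlc : (C a * X + C b).leadingCoeff * (W a b d (n + 1)).leadingCoeff = a ^ (n + 1) := by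
      rw [hl, ih2.2, Nat.add_sub_cancel, pow_succ']
    have hdeg : ((C a * X + C b) * W a b d (n + 1)).natDegree = n + 2 := by
      rw [natDegree_mul' (by rw [hlc]; positivity), hn, ih2.1]
      ring
    have hlt : (C d * W a b d n).natDegree < ((C a * X + C b) * W a b d (n + 1)).natDegree := by
      rw [hdeg]
      exact (natDegree_C_mul_le _ _).trans_lt (by omega)
    rw [W_add_two]
    refine ⟨(natDegree_add_eq_left_of_natDegree_lt hlt).trans hdeg, ?_⟩
    rw [leadingCoeff_add_of_degree_lt' (degree_lt_degree hlt), leadingCoeff_mul, hlc]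
    rfl

lemma natDegree_W {a : ℝ} (ha : 0 < a) (b d : ℝ) (n : ℕ) : (W a b d n).natDegree = n :=
  (natDegree_W_and_leadingCoeff ha b d n).1

lemma leadingCoeff_W_pos {a : ℝ} (ha : 0 < a) (b d : ℝ) (n : ℕ) :
    0 < (W a b d n).leadingCoeff := by
  rw [(natDegree_W_and_leadingCoeff ha b d n).2]
  positivity

lemma W_ne_zero {a : ℝ} (ha : 0 < a) (b d : ℝ) (n : ℕ) : W a b d n ≠ 0 :=
  leadingCoeff_ne_zero.1 (leadingCoeff_W_pos ha b d n).ne'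

/-! ### Values at special points -/

lemma sin_mul_eval_W {a b d s x θ : ℝ} (hs : s ^ 2 = -d) (hx : a * x + b = 2 * s * Real.cos θ)
    (n : ℕ) : Real.sin θ * (W a b d (n + 1)).eval x =
      s ^ n * (x * Real.sin ((n + 1) * θ) - s * Real.sin (n * θ)) := by
  have hd : d = -s ^ 2 := by linarith
  have hsin : ∀ t : ℝ, Real.sin ((t + 2) * θ) =
      2 * Real.cos θ * Real.sin ((t + 1) * θ) - Real.sin (t * θ) := fun t => by
    rw [show (t + 2) * θ = (t + 1) * θ + θ by ring, show t * θ = (t + 1) * θ - θ by ring,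
      Real.sin_add, Real.sin_sub]
    ring
  induction n using Nat.twoStepInduction with
  | zero => simp [eval_W_one, mul_comm]
  | one =>
    have h2 := hsin 0
    simp only [zero_add, one_mul, zero_mul, Real.sin_zero, sub_zero] at h2
    rw [eval_W_add_two, eval_W_one, eval_W_zero, hx, hd]
    push_cast
    rw [show (1 + 1 : ℝ) = 2 by norm_num, h2, one_mul]
    ring
  | more n ih1 ih2 =>
    rw [eval_W_add_two, hx]
    have h1 := hsin n
    have h2 := hsin (n + 1)
    push_cast at ih2 ⊢
    rw [show (n + 1 + 1 : ℝ) = n + 2 by ring] at ih2 h2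
    rw [show (n + 1 + 2 : ℝ) = n + 2 + 1 by ring] at h2
    rw [h2]
    rw [h1] at ih2 ⊢
    linear_combination 2 * s * Real.cos θ * ih2 + d * ih1 +
      s ^ n * (x * Real.sin ((n + 1) * θ) - s * Real.sin (n * θ)) * hs

/-- The point of the `x`-axis corresponding to the angle `kπ/n`: there
`ax + b = 2√(-d) cos (kπ/n)`. -/
noncomputable def cosPoint (a b d : ℝ) (n k : ℕ) : ℝ :=
  (-b + 2 * √(-d) * Real.cos (k * Real.pi / n)) / a

lemma eval_W_cosPoint {a d : ℝ} (ha : 0 < a) (b : ℝ) (hd : d < 0) {n k : ℕ} (hk : 1 ≤ k)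
    (hkn : k < n) : (W a b d n).eval (cosPoint a b d n k) = (-1) ^ k * √(-d) ^ n := by
  obtain ⟨n, rfl⟩ : ∃ m, n = m + 1 := ⟨n - 1, by omega⟩
  set θ := (k : ℝ) * Real.pi / (n + 1 : ℕ) with hθ
  have hk0 : (0 : ℝ) < k := by exact_mod_cast hk
  have hkn' : (k : ℝ) < (n + 1 : ℕ) := by exact_mod_cast hkn
  have hn0 : (0 : ℝ) < (n + 1 : ℕ) := hk0.trans hkn'
  have hsin : 0 < Real.sin θ := by
    apply Real.sin_pos_of_pos_of_lt_pi
    · rw [hθ]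
      have := Real.pi_pos
      positivity
    · rw [hθ, div_lt_iff₀ hn0, mul_comm]
      exact mul_lt_mul_of_pos_left hkn' Real.pi_pos
  have hx : a * cosPoint a b d (n + 1) k + b = 2 * √(-d) * Real.cos θ := by
    rw [cosPoint, ← hθ]
    field_simp
    ring
  have h := sin_mul_eval_W (Real.sq_sqrt (by linarith : (0 : ℝ) ≤ -d)) hx n
  have h1 : ((n : ℝ) + 1) * θ = k * Real.pi := by
    rw [hθ]
    push_cast
    field_simp
  rw [h1, show (n : ℝ) * θ = k * Real.pi - θ by linarith, Real.sin_sub, Real.sin_nat_mul_pi,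
    Real.cos_nat_mul_pi] at h
  apply mul_left_cancel₀ hsin.ne'
  rw [h]
  ring

lemma cosPoint_lt_cosPoint {a d : ℝ} (ha : 0 < a) (b : ℝ) (hd : d < 0) {n k l : ℕ} (hkl : k < l)
    (hln : l ≤ n) : cosPoint a b d n l < cosPoint a b d n k := by
  have hs : 0 < √(-d) := Real.sqrt_pos.2 (by linarith)
  have hn : (0 : ℝ) < n := by exact_mod_cast (by omega : 0 < n)
  have hpi := Real.pi_pos
  have hcos : Real.cos (l * Real.pi / n) < Real.cos (k * Real.pi / n) := by
    apply Real.cos_lt_cos_of_nonneg_of_le_pi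
    · positivity
    · rw [div_le_iff₀ hn, mul_comm]
      exact mul_le_mul_of_nonneg_left (by exact_mod_cast hln) hpi.le
    · gcongr
  rw [cosPoint, cosPoint]
  gcongr

lemma cosPoint_zero (a b d : ℝ) (n : ℕ) : cosPoint a b d n 0 = xDeltaPlus a b d := by
  simp [cosPoint, xDeltaPlus]

lemma cosPoint_self (a b d : ℝ) {n : ℕ} (hn : n ≠ 0) :
    cosPoint a b d n n = xDeltaMinus a b d := by
  have : (n : ℝ) ≠ 0 := by exact_mod_cast hn
  rw [cosPoint, xDeltaMinus, mul_div_cancel_left₀ _ this, Real.cos_pi]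
  ring

lemma tendsto_cosPoint (a b d : ℝ) (k : ℕ) :
    Tendsto (fun n => cosPoint a b d n k) atTop (𝓝 (xDeltaPlus a b d)) := by
  have h0 : Tendsto (fun n : ℕ => (k : ℝ) * Real.pi / n) atTop (𝓝 0) :=
    tendsto_const_div_atTop_nhds_zero_nat _
  have h1 := (Real.continuous_cos.tendsto 0).comp h0
  rw [Real.cos_zero] at h1
  have h2 := ((h1.const_mul (2 * √(-d))).const_add (-b)).div_const a
  simpa [cosPoint, xDeltaPlus, Function.comp_def] using h2

lemma eval_W_xDeltaPlus {a d : ℝ} (ha : 0 < a) (b : ℝ) (hd : d < 0) (n : ℕ) :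
    (W a b d (n + 1)).eval (xDeltaPlus a b d) =
      √(-d) ^ n * ((n + 1) * xDeltaPlus a b d - n * √(-d)) := by
  have hx : a * xDeltaPlus a b d + b = 2 * √(-d) := by
    rw [xDeltaPlus]
    field_simp
    ring
  have hs : d = -√(-d) ^ 2 := by rw [Real.sq_sqrt (by linarith)]; ring
  generalize √(-d) = s at *
  induction n using Nat.twoStepInduction with
  | zero => simp [eval_W_one]
  | one =>
    rw [eval_W_add_two, eval_W_one, eval_W_zero, hx]
    push_cast
    linear_combination hs
  | more n ih1 ih2 =>
    rw [eval_W_add_two, ih1, ih2, hx]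
    push_cast
    linear_combination (s ^ n * ((n + 1) * xDeltaPlus a b d - n * s)) * hs

lemma eval_W_xDeltaPlus_pos {a b d : ℝ} (ha : 0 < a) (hd : d < 0) (hab : b ≤ (2 - a) * √(-d))
    (n : ℕ) : 0 < (W a b d n).eval (xDeltaPlus a b d) := by
  have hs : 0 < √(-d) := Real.sqrt_pos.2 (by linarith)
  have hx : √(-d) ≤ xDeltaPlus a b d := by
    rw [xDeltaPlus, le_div_iff₀ ha]
    linarith
  cases n with
  | zero => simp [eval_W_zero]
  | succ n =>
    rw [eval_W_xDeltaPlus ha b hd]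
    have hn : (0 : ℝ) ≤ n := n.cast_nonneg
    have : 0 < (n + 1) * xDeltaPlus a b d - n * √(-d) := by nlinarith
    positivity

/-- Where the characteristic equation `t² = (ax + b)t + d` has the solution `t = x`, the sequence
`W_n(x)` is geometric. -/
lemma eval_W_of_fixed {a b d x : ℝ} (hx : (a - 1) * x ^ 2 + b * x + d = 0) (n : ℕ) :
    (W a b d n).eval x = x ^ n := by
  induction n using Nat.twoStepInduction with
  | zero => simp [eval_W_zero]
  | one => simp [eval_W_one]
  | more n ih1 ih2 =>
    rw [eval_W_add_two, ih1, ih2]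
    linear_combination x ^ n * hx

/-! ### The point `x_g^+` -/

/-- When `b > (2 - a)√(-d)`, the number `x_g^+` is the root in `(0, √(-d))` of
`(a - 1)t² + bt + d`, a polynomial which is negative at `0` and positive at `√(-d)`. -/
lemma xgPlus_spec {a b d : ℝ} (hd : d < 0) (hab : (2 - a) * √(-d) < b) :
    XgDefined a b d ∧ 0 < xgPlus a b d ∧ xgPlus a b d < √(-d) ∧
      (a - 1) * xgPlus a b d ^ 2 + b * xgPlus a b d + d = 0 := by
  have hs : 0 < √(-d) := Real.sqrt_pos.2 (by linarith)
  have hds : d = -√(-d) ^ 2 := by rw [Real.sq_sqrt (by linarith)]; ring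
  set s := √(-d) with hsdef
  have hfs : 0 < (a - 1) * s ^ 2 + b * s + d := by rw [hds]; nlinarith
  obtain ⟨g, ⟨hg0, hgs⟩, hg⟩ := intermediate_value_Ioo hs.le
    (f := fun t => (a - 1) * t ^ 2 + b * t + d) (by fun_prop)
    (show (0 : ℝ) ∈ Set.Ioo _ _ from ⟨by simpa using hd, hfs⟩)
  simp only at hg
  -- The linear factor `(a - 1)(t + g) + b` is positive at `t = 0` and at `t = s`, hence at `t = g`.
  have h0 : 0 < (a - 1) * g + b := by
    by_contra! h
    nlinarith
  have h1 : 0 < (a - 1) * (s + g) + b := by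
    by_contra! h
    nlinarith
  have h2 : 0 < 2 * (a - 1) * g + b := by
    by_contra! h
    nlinarith
  have hdisc : b ^ 2 - 4 * d * (a - 1) = (2 * (a - 1) * g + b) ^ 2 := by
    linear_combination -4 * (a - 1) * hg
  have hxg : XgDefined a b d ∧ xgPlus a b d = g := by
    by_cases ha : a = 1
    · subst ha
      have hb : b ≠ 0 := by
        rintro rfl
        simp at h0
      refine ⟨Or.inr ⟨rfl, hb⟩, ?_⟩
      rw [xgPlus, if_pos rfl, div_eq_iff hb]
      linarith
    · have ha' : a - 1 ≠ 0 := sub_ne_zero.2 ha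
      refine ⟨Or.inl ⟨ha, hdisc ▸ sq_nonneg _⟩, ?_⟩
      rw [xgPlus, if_neg ha, hdisc, Real.sqrt_sq h2.le]
      field_simp
      ring
  rw [hxg.2]
  exact ⟨hxg.1, hg0, hgs, hg⟩

lemma quadratic_pos_of_xgPlus_lt {a b d t : ℝ} (hd : d < 0) (hab : (2 - a) * √(-d) < b)
    (ht : xgPlus a b d < t) (hts : t ≤ √(-d)) : 0 < (a - 1) * t ^ 2 + b * t + d := by
  obtain ⟨-, hg0, hgs, hg⟩ := xgPlus_spec hd hab
  have hs : 0 < √(-d) := hg0.trans hgs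
  have hds : d = -√(-d) ^ 2 := by rw [Real.sq_sqrt (by linarith)]; ring
  generalize √(-d) = s at *
  generalize xgPlus a b d = g at *
  have h0 : 0 < (a - 1) * g + b := by
    by_contra! h
    nlinarith
  have hfs : 0 < (a - 1) * s ^ 2 + b * s + d := by rw [hds]; nlinarith
  have h1 : 0 < (a - 1) * (s + g) + b := by
    by_contra! h
    nlinarith
  have h2 : 0 < (a - 1) * (t + g) + b := by
    by_contra! h
    nlinarith
  nlinarith [mul_pos (sub_pos.2 ht) h2]

lemma xDeltaPlus_le_xgPlus {a b d : ℝ} (ha : 0 < a) (hd : d < 0) (hab : (2 - a) * √(-d) < b) :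
    xDeltaPlus a b d ≤ xgPlus a b d := by
  obtain ⟨-, hg0, hgs, hg⟩ := xgPlus_spec hd hab
  have hds : d = -√(-d) ^ 2 := by rw [Real.sq_sqrt (by linarith)]; ring
  rw [xDeltaPlus, div_le_iff₀ ha]
  generalize √(-d) = s at *
  generalize xgPlus a b d = g at *
  have h : g * (2 * s) ≤ g * (g * a + b) := by nlinarith [sq_nonneg (g - s)]
  linarith [le_of_mul_le_mul_left h hg0]

lemma xgMinus_eq_neg_xgPlus (a b d : ℝ) : xgMinus a b d = -xgPlus a (-b) d := by
  rw [xgMinus, xgPlus]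
  split_ifs
  · rw [div_neg, neg_neg]
  · rw [← neg_div]
    ring_nf

lemma xDeltaMinus_eq_neg_xDeltaPlus (a b d : ℝ) :
    xDeltaMinus a b d = -xDeltaPlus a (-b) d := by
  rw [xDeltaMinus, xDeltaPlus, ← neg_div]
  ring_nf

/-- If the characteristic equation at `x` has roots `l ≤ m` with `x < l`, then
`W_{n+1}(x) - l W_n(x) = m^n (x - l)`, which makes `W_n(x) / l^n` decrease at least linearly. -/
lemma eval_W_le_of_lt {a b d x l m : ℝ} (hl : 0 < l) (hlm : l ≤ m) (hsum : l + m = a * x + b)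
    (hprod : l * m = -d) (hx : x < l) (n : ℕ) :
    (W a b d n).eval x ≤ l ^ n * (1 - n * ((l - x) / l)) := by
  have hdiff : ∀ n, (W a b d (n + 1)).eval x - l * (W a b d n).eval x = m ^ n * (x - l) := by
    intro n
    induction n with
    | zero => simp [eval_W_zero, eval_W_one]
    | succ n ih =>
      rw [eval_W_add_two, ← hsum]
      linear_combination m * ih + (W a b d n).eval x * hprod
  induction n with
  | zero => simp [eval_W_zero]
  | succ n ih =>
    have h1 : l ^ n * (l - x) ≤ m ^ n * (l - x) :=
      mul_le_mul_of_nonneg_right (pow_le_pow_left₀ hl.le hlm n) (by linarith)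
    have h2 := mul_le_mul_of_nonneg_left ih hl.le
    have h3 : l ^ (n + 1) * (1 - ((n + 1 : ℕ) : ℝ) * ((l - x) / l)) =
        l * (l ^ n * (1 - n * ((l - x) / l))) - l ^ n * (l - x) := by
      push_cast
      field_simp
      ring
    linarith [hdiff n]

/-- Arbitrarily close to `x_g^+` on the left, some `W_n` takes a nonpositive value. The points used
are those `u` for which the characteristic equation has a root `l` slightly above `x_g^+`. -/
lemma exists_eval_W_nonpos {a b d v : ℝ} (ha : 0 < a) (hd : d < 0) (hab : (2 - a) * √(-d) < b)
    (hv : v < xgPlus a b d) : ∃ u, v < u ∧ ∃ n, (W a b d n).eval u ≤ 0 := by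
  obtain ⟨-, hg0, hgs, hg⟩ := xgPlus_spec hd hab
  have hpos := fun t => quadratic_pos_of_xgPlus_lt (t := t) hd hab
  have hds : d = -√(-d) ^ 2 := by rw [Real.sq_sqrt (by linarith)]; ring
  generalize √(-d) = s at *
  generalize xgPlus a b d = g at *
  have hval : (g + -d / g - b) / a = g := by
    field_simp
    linear_combination -hg
  have hcont : ContinuousAt (fun l => (l + -d / l - b) / a) g := by
    have := hg0.ne'
    fun_prop (disch := assumption)
  have hev : ∀ᶠ l in 𝓝 g, v < (l + -d / l - b) / a :=
    hcont.eventually_const_lt (by simpa only [hval] using hv)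
  obtain ⟨l, hl, hgl, hls⟩ := ((hev.filter_mono nhdsWithin_le_nhds).and
    (Ioo_mem_nhdsGT hgs)).exists
  have hl0 : 0 < l := hg0.trans hgl
  refine ⟨_, hl, ?_⟩
  set u := (l + -d / l - b) / a with hu
  have hsum : l + -d / l = a * u + b := by
    rw [hu]
    field_simp
    ring
  have hlm : l ≤ -d / l := by
    rw [le_div_iff₀ hl0, hds]
    nlinarith
  have hul : u < l := by
    have h := hpos l hgl hls.le
    have h' : l * (a * u + b) = l ^ 2 - d := by
      rw [← hsum]
      field_simp
      ring
    by_contra! hle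
    nlinarith [mul_le_mul_of_nonneg_left hle (mul_pos ha hl0).le]
  obtain ⟨n, hn⟩ := Archimedean.arch (1 : ℝ) (div_pos (sub_pos.2 hul) hl0)
  rw [nsmul_eq_mul] at hn
  refine ⟨n, (eval_W_le_of_lt hl0 hlm hsum (mul_div_cancel₀ _ hl0.ne') hul n).trans ?_⟩
  exact mul_nonpos_of_nonneg_of_nonpos (by positivity) (by linarith)

/-! ### End points of the range of the roots -/

/-- The limit of the largest root, which is also a strict upper bound for all roots. -/
noncomputable def rightEnd (a b d : ℝ) : ℝ :=
  if b ≤ (2 - a) * √(-d) then xDeltaPlus a b d else xgPlus a b d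

/-- The limit of the smallest root, which is also a strict lower bound for all roots; it is the
mirror image of `rightEnd` under `(b, x) ↦ (-b, -x)`. -/
noncomputable def leftEnd (a b d : ℝ) : ℝ := -rightEnd a (-b) d

lemma rightEnd_of_le {a b d : ℝ} (h : b ≤ (2 - a) * √(-d)) :
    rightEnd a b d = xDeltaPlus a b d := if_pos h

lemma rightEnd_of_lt {a b d : ℝ} (h : (2 - a) * √(-d) < b) :
    rightEnd a b d = xgPlus a b d := if_neg h.not_ge

lemma leftEnd_of_le {a b d : ℝ} (h : -b ≤ (2 - a) * √(-d)) :
    leftEnd a b d = xDeltaMinus a b d := by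
  rw [leftEnd, rightEnd_of_le h, xDeltaMinus_eq_neg_xDeltaPlus]

lemma leftEnd_of_lt {a b d : ℝ} (h : (2 - a) * √(-d) < -b) :
    leftEnd a b d = xgMinus a b d := by
  rw [leftEnd, rightEnd_of_lt h, xgMinus_eq_neg_xgPlus]

lemma eval_W_rightEnd_pos {a d : ℝ} (ha : 0 < a) (b : ℝ) (hd : d < 0) (n : ℕ) :
    0 < (W a b d n).eval (rightEnd a b d) := by
  rcases le_or_gt b ((2 - a) * √(-d)) with h | h
  · rw [rightEnd_of_le h]
    exact eval_W_xDeltaPlus_pos ha hd h n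
  · obtain ⟨-, hpos, -, hg⟩ := xgPlus_spec hd h
    rw [rightEnd_of_lt h, eval_W_of_fixed hg]
    positivity

lemma eval_W_leftEnd_pos {a d : ℝ} (ha : 0 < a) (b : ℝ) (hd : d < 0) (n : ℕ) :
    0 < (-1) ^ n * (W a b d n).eval (leftEnd a b d) := by
  rw [leftEnd, ← eval_W_neg]
  exact eval_W_rightEnd_pos ha (-b) hd n

lemma xDeltaPlus_le_rightEnd {a d : ℝ} (ha : 0 < a) (b : ℝ) (hd : d < 0) :
    xDeltaPlus a b d ≤ rightEnd a b d := by
  rcases le_or_gt b ((2 - a) * √(-d)) with h | h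
  · rw [rightEnd_of_le h]
  · rw [rightEnd_of_lt h]
    exact xDeltaPlus_le_xgPlus ha hd h

lemma leftEnd_le_xDeltaMinus {a d : ℝ} (ha : 0 < a) (b : ℝ) (hd : d < 0) :
    leftEnd a b d ≤ xDeltaMinus a b d := by
  rw [leftEnd, xDeltaMinus_eq_neg_xDeltaPlus]
  exact neg_le_neg (xDeltaPlus_le_rightEnd ha (-b) hd)

/-! ### Location of the roots -/

/-- Increasing points, for `i = 0, …, n`, at which `W_n` alternates in sign: the two end points
and, between them, the points with angles `kπ/n` in decreasing order of `k = n - i`. -/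
noncomputable def samplePoint (a b d : ℝ) (n i : ℕ) : ℝ :=
  if i = 0 then leftEnd a b d else if i < n then cosPoint a b d n (n - i) else rightEnd a b d

lemma samplePoint_zero (a b d : ℝ) (n : ℕ) : samplePoint a b d n 0 = leftEnd a b d := if_pos rfl

lemma samplePoint_of_lt (a b d : ℝ) {n i : ℕ} (h0 : i ≠ 0) (hi : i < n) :
    samplePoint a b d n i = cosPoint a b d n (n - i) := by
  rw [samplePoint, if_neg h0, if_pos hi]

lemma samplePoint_self (a b d : ℝ) {n : ℕ} (hn : n ≠ 0) :
    samplePoint a b d n n = rightEnd a b d := by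
  rw [samplePoint, if_neg hn, if_neg (lt_irrefl n)]

lemma samplePoint_lt_succ {a d : ℝ} (ha : 0 < a) (b : ℝ) (hd : d < 0) {n i : ℕ} (hi : i < n) :
    samplePoint a b d n i < samplePoint a b d n (i + 1) := by
  have hL := leftEnd_le_xDeltaMinus ha b hd
  have hR := xDeltaPlus_le_rightEnd ha b hd
  have hlt : ∀ {k l : ℕ}, k < l → l ≤ n → cosPoint a b d n l < cosPoint a b d n k :=
    cosPoint_lt_cosPoint ha b hd
  rw [← cosPoint_self a b d (n := n) (by omega)] at hL
  rw [← cosPoint_zero a b d n] at hR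
  rcases Nat.eq_zero_or_pos i with rfl | h0
  · rw [samplePoint_zero]
    refine hL.trans_lt ?_
    rcases Nat.lt_or_ge 1 n with h1 | h1
    · rw [samplePoint_of_lt a b d (by omega) h1]
      exact hlt (by omega) le_rfl
    · obtain rfl : n = 1 := by omega
      rw [zero_add, samplePoint_self a b d one_ne_zero]
      exact (hlt zero_lt_one le_rfl).trans_le hR
  · rw [samplePoint_of_lt a b d h0.ne' hi]
    rcases Nat.lt_or_ge (i + 1) n with h1 | h1
    · rw [samplePoint_of_lt a b d (by omega) h1]
      exact hlt (by omega) (by omega)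
    · obtain rfl : n = i + 1 := by omega
      rw [samplePoint_self a b d (by omega)]
      exact (hlt (by omega) (by omega)).trans_le hR

lemma eval_W_samplePoint {a d : ℝ} (ha : 0 < a) (b : ℝ) (hd : d < 0) {n i : ℕ} (hi : i ≤ n) :
    0 < (-1) ^ (n - i) * (W a b d n).eval (samplePoint a b d n i) := by
  have hs : 0 < √(-d) := Real.sqrt_pos.2 (by linarith)
  rcases Nat.eq_zero_or_pos i with rfl | h0
  · exact eval_W_leftEnd_pos ha b hd n
  rcases hi.lt_or_eq with h1 | rfl
  · rw [samplePoint_of_lt a b d h0.ne' h1, eval_W_cosPoint ha b hd (by omega) (by omega),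
      ← mul_assoc, ← mul_pow]
    norm_num
    positivity
  · rw [samplePoint_self a b d h0.ne', Nat.sub_self, pow_zero, one_mul]
    exact eval_W_rightEnd_pos ha b hd i

lemma exists_isIncreasingList_W {a d : ℝ} (ha : 0 < a) (b : ℝ) (hd : d < 0) (n : ℕ) :
    ∃ s : ℕ → ℝ, IsIncreasingList (zeroSet (W a b d n)) n s :=
  (exists_isIncreasingList_of_alternating (W_ne_zero ha b d n) (natDegree_W ha b d n)
    (y := samplePoint a b d n) (fun _ hi => samplePoint_lt_succ ha b hd hi)
    (fun _ hi => eval_W_samplePoint ha b hd hi)).imp fun _ h => h.1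

section Enumeration

variable {a b d : ℝ} {ξ : ℕ → ℕ → ℝ}

lemma root_mem_gap (ha : 0 < a) (hd : d < 0)
    (hξ : ∀ n, IsIncreasingList (zeroSet (W a b d n)) n (ξ n)) {n i : ℕ} (hi : i < n) :
    samplePoint a b d n i < ξ n (i + 1) ∧ ξ n (i + 1) < samplePoint a b d n (i + 1) :=
  (hξ n).mem_gap (W_ne_zero ha b d n) (natDegree_W ha b d n)
    (y := samplePoint a b d n) (fun _ hi => samplePoint_lt_succ ha b hd hi)
    (fun _ hi => eval_W_samplePoint ha b hd hi) i hi

lemma leftEnd_lt_root (ha : 0 < a) (hd : d < 0)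
    (hξ : ∀ n, IsIncreasingList (zeroSet (W a b d n)) n (ξ n)) {n : ℕ} (hn : 0 < n) :
    leftEnd a b d < ξ n 1 := by
  simpa [samplePoint_zero] using (root_mem_gap ha hd hξ hn).1

lemma root_lt_rightEnd (ha : 0 < a) (hd : d < 0)
    (hξ : ∀ n, IsIncreasingList (zeroSet (W a b d n)) n (ξ n)) {n : ℕ} (hn : 0 < n) :
    ξ n n < rightEnd a b d := by
  have h := (root_mem_gap ha hd hξ (n := n) (i := n - 1) (by omega)).2
  rwa [Nat.sub_add_cancel hn, samplePoint_self a b d hn.ne'] at h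

/-! ### Interlacing -/

/-- At a root of `W_{n+1}` the values of `W_{n+2}` and `W_n` have opposite signs, so interlacing of
`W_{n+1}` and `W_n` makes `W_{n+2}` alternate at the roots of `W_{n+1}` and the two end points. -/
theorem roots_interlace (ha : 0 < a) (hd : d < 0)
    (hξ : ∀ n, IsIncreasingList (zeroSet (W a b d n)) n (ξ n)) (n : ℕ) :
    ∀ i, 1 ≤ i → i ≤ n → ξ (n + 1) i < ξ n i ∧ ξ n i < ξ (n + 1) (i + 1) := by
  induction n with
  | zero => intro i h1 h2; omega
  | succ n ih =>
    set y : ℕ → ℝ := fun i =>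
      if i = 0 then leftEnd a b d else if i = n + 2 then rightEnd a b d else ξ (n + 1) i with hy
    have hy0 : y 0 = leftEnd a b d := if_pos rfl
    have hyR : y (n + 2) = rightEnd a b d := by simp [hy]
    have hyi : ∀ i, 1 ≤ i → i ≤ n + 1 → y i = ξ (n + 1) i := fun i h1 h2 => by
      simp [hy, show i ≠ 0 by omega, show i ≠ n + 2 by omega]
    have hmono : ∀ i < n + 2, y i < y (i + 1) := by
      intro i hi
      rcases Nat.eq_zero_or_pos i with rfl | h0
      · rw [hy0, hyi 1 le_rfl (by omega)]
        exact leftEnd_lt_root ha hd hξ (by omega)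
      · rw [hyi i h0 (by omega)]
        rcases Nat.lt_or_ge i (n + 1) with h1 | h1
        · rw [hyi (i + 1) (by omega) h1]
          exact (hξ (n + 1)).1 ⟨h0, by omega⟩ ⟨by omega, h1⟩ (Nat.lt_succ_self i)
        · obtain rfl : i = n + 1 := by omega
          rw [hyR]
          exact root_lt_rightEnd ha hd hξ (by omega)
    have hsign : ∀ i ≤ n + 2, 0 < (-1) ^ (n + 2 - i) * (W a b d (n + 2)).eval (y i) := by
      intro i hi
      rcases Nat.eq_zero_or_pos i with rfl | h0
      · rw [hy0]
        exact eval_W_leftEnd_pos ha b hd (n + 2)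
      rcases hi.lt_or_eq with h1 | rfl
      · have hroot : (W a b d (n + 1)).eval (ξ (n + 1) i) = 0 := (hξ (n + 1)).mem h0 (by omega)
        have hle : ∀ {k l}, 1 ≤ k → k ≤ l → l ≤ n + 1 → ξ (n + 1) k ≤ ξ (n + 1) l :=
          fun hk hkl hl =>
            (hξ (n + 1)).1.monotoneOn ⟨hk, hkl.trans hl⟩ ⟨hk.trans hkl, hl⟩ hkl
        have h := (hξ n).sign_eval (leadingCoeff_W_pos ha b d n) (natDegree_W ha b d n)
          (i := i - 1) (x := ξ (n + 1) i) (by omega)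
          (fun k hk hki => (ih k hk (by omega)).2.trans_le (hle (by omega) (by omega) (by omega)))
          (fun k hik hk => (hle h0 (by omega) (by omega)).trans_lt (ih k (by omega) hk).1)
        rw [hyi i h0 (by omega), eval_W_add_two, hroot,
          show n + 2 - i = n - (i - 1) + 1 by omega, pow_succ]
        nlinarith
      · rw [hyR, Nat.sub_self, pow_zero, one_mul]
        exact eval_W_rightEnd_pos ha b hd (n + 2)
    have hgap := (hξ (n + 2)).mem_gap (W_ne_zero ha b d (n + 2)) (natDegree_W ha b d (n + 2))
      hmono hsign
    intro i h1 h2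
    have hl := (hgap (i - 1) (by omega)).2
    have hr := (hgap i (by omega)).1
    rw [Nat.sub_add_cancel h1, hyi i h1 h2] at hl
    rw [hyi i h1 h2] at hr
    exact ⟨hl, hr⟩

/-! ### Limits of the largest roots -/

lemma strictMonoOn_root (ha : 0 < a) (hd : d < 0)
    (hξ : ∀ n, IsIncreasingList (zeroSet (W a b d n)) n (ξ n)) {j : ℕ} (hj : 1 ≤ j) :
    StrictMonoOn (fun n => ξ n (n + 1 - j)) (Set.Ici j) := by
  refine strictMonoOn_of_lt_add_one Set.ordConnected_Ici fun n _ hn _ => ?_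
  have hn : j ≤ n := hn
  have h := (roots_interlace ha hd hξ n (n + 1 - j) (by omega) (by omega)).2
  rwa [show n + 1 - j + 1 = n + 1 + 1 - j by omega] at h

lemma cosPoint_lt_root (ha : 0 < a) (hd : d < 0)
    (hξ : ∀ n, IsIncreasingList (zeroSet (W a b d n)) n (ξ n)) {n j : ℕ} (hj : 1 ≤ j)
    (hn : j < n) : cosPoint a b d n j < ξ n (n + 1 - j) := by
  have h := (root_mem_gap ha hd hξ (n := n) (i := n - j) (by omega)).1
  rwa [samplePoint_of_lt a b d (by omega) (by omega), Nat.sub_sub_self hn.le,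
    show n - j + 1 = n + 1 - j by omega] at h

lemma root_lt_xDeltaPlus (ha : 0 < a) (hd : d < 0)
    (hξ : ∀ n, IsIncreasingList (zeroSet (W a b d n)) n (ξ n)) {n j : ℕ} (hj : 2 ≤ j)
    (hn : j ≤ n) : ξ n (n + 1 - j) < xDeltaPlus a b d := by
  have h := (root_mem_gap ha hd hξ (n := n) (i := n - j) (by omega)).2
  rw [samplePoint_of_lt a b d (by omega) (by omega), show n - j + 1 = n + 1 - j by omega] at h
  rw [← cosPoint_zero a b d n]
  exact h.trans (cosPoint_lt_cosPoint ha b hd (by omega) (by omega))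

theorem increasesTo_xDeltaPlus (ha : 0 < a) (hd : d < 0)
    (hξ : ∀ n, IsIncreasingList (zeroSet (W a b d n)) n (ξ n)) {j : ℕ} (hj : 2 ≤ j) :
    IncreasesTo j (fun n => ξ n (n + 1 - j)) (xDeltaPlus a b d) := by
  refine ⟨strictMonoOn_root ha hd hξ (by omega),
    tendsto_of_tendsto_of_tendsto_of_le_of_le' (tendsto_cosPoint a b d j) tendsto_const_nhds ?_ ?_⟩
  · filter_upwards [eventually_gt_atTop j] with n hn
    exact (cosPoint_lt_root ha hd hξ (by omega) hn).le
  · filter_upwards [eventually_ge_atTop j] with n hn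
    exact (root_lt_xDeltaPlus ha hd hξ hj hn).le

theorem increasesTo_rightEnd (ha : 0 < a) (hd : d < 0)
    (hξ : ∀ n, IsIncreasingList (zeroSet (W a b d n)) n (ξ n)) :
    IncreasesTo 1 (fun n => ξ n n) (rightEnd a b d) := by
  have hmono : StrictMonoOn (fun n => ξ n n) (Set.Ici 1) := strictMonoOn_root ha hd hξ le_rfl
  refine ⟨hmono, ?_⟩
  rcases le_or_gt b ((2 - a) * √(-d)) with h | h
  · have hlt := fun n => root_lt_rightEnd (n := n) ha hd hξ
    rw [rightEnd_of_le h] at hlt ⊢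
    refine tendsto_of_tendsto_of_tendsto_of_le_of_le' (tendsto_cosPoint a b d 1)
      tendsto_const_nhds ?_ ?_
    · filter_upwards [eventually_gt_atTop 1] with n hn
      exact (cosPoint_lt_root ha hd hξ le_rfl hn).le
    · filter_upwards [eventually_gt_atTop 0] with n hn
      exact (hlt n hn).le
  · refine tendsto_order.2 ⟨fun v hv => ?_, fun v hv => ?_⟩
    · rw [rightEnd_of_lt h] at hv
      obtain ⟨u, hvu, N, hN⟩ := exists_eval_W_nonpos ha hd h hv
      have hN0 : 1 ≤ N := by
        by_contra! h0
        obtain rfl : N = 0 := by omega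
        rw [eval_W_zero] at hN
        linarith
      -- `W_N` is positive to the right of its largest root.
      have hu : u ≤ ξ N N := by
        by_contra! hlt
        have hpos := (hξ N).sign_eval (leadingCoeff_W_pos ha b d N) (natDegree_W ha b d N)
          (i := N) (x := u) le_rfl
          (fun k hk hkN => ((hξ N).1.monotoneOn ⟨hk, hkN⟩ ⟨hN0, le_rfl⟩ hkN).trans_lt hlt)
          (fun k hk hkN => by omega)
        rw [Nat.sub_self, pow_zero, one_mul] at hpos
        linarith
      filter_upwards [eventually_ge_atTop N] with n hn
      exact (hvu.trans_le hu).trans_le (hmono.monotoneOn hN0 (hN0.trans hn) hn)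
    · filter_upwards [eventually_gt_atTop 0] with n hn
      exact (root_lt_rightEnd ha hd hξ hn).trans hv

/-! ### Limits of the smallest roots, by reflection -/

lemma isIncreasingList_neg (hξ : ∀ n, IsIncreasingList (zeroSet (W a b d n)) n (ξ n)) (n : ℕ) :
    IsIncreasingList (zeroSet (W a (-b) d n)) n (fun i => -ξ n (n + 1 - i)) := by
  constructor
  · intro i hi k hk hik
    have := hi.1
    have := hk.1
    have := hk.2
    exact neg_lt_neg ((hξ n).1 ⟨by omega, by omega⟩ ⟨by omega, by omega⟩ (by omega))
  · ext x
    have hx : x ∈ zeroSet (W a (-b) d n) ↔ -x ∈ zeroSet (W a b d n) := by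
      simp [zeroSet, eval_W_neg]
    rw [hx, ← (hξ n).2]
    constructor
    · rintro ⟨i, ⟨h1, h2⟩, rfl⟩
      exact ⟨n + 1 - i, ⟨by omega, by omega⟩, (neg_neg _).symm⟩
    · rintro ⟨i, ⟨h1, h2⟩, hi⟩
      refine ⟨n + 1 - i, ⟨by omega, by omega⟩, ?_⟩
      dsimp only
      rw [show n + 1 - (n + 1 - i) = i by omega, hi, neg_neg]

lemma IncreasesTo.decreasesTo_of_eq_neg {n₀ : ℕ} {u v : ℕ → ℝ} {x : ℝ} (h : IncreasesTo n₀ u x)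
    (huv : ∀ n, n₀ ≤ n → u n = -v n) : DecreasesTo n₀ v (-x) := by
  refine ⟨fun m hm n hn hmn => ?_, h.2.neg.congr' ?_⟩
  · have := h.1 hm hn hmn
    rw [huv m hm, huv n hn] at this
    exact neg_lt_neg_iff.1 this
  · filter_upwards [eventually_ge_atTop n₀] with n hn
    rw [huv n hn, neg_neg]

theorem decreasesTo_xDeltaMinus (ha : 0 < a) (hd : d < 0)
    (hξ : ∀ n, IsIncreasingList (zeroSet (W a b d n)) n (ξ n)) {j : ℕ} (hj : 2 ≤ j) :
    DecreasesTo j (fun n => ξ n j) (xDeltaMinus a b d) := by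
  rw [xDeltaMinus_eq_neg_xDeltaPlus]
  refine (increasesTo_xDeltaPlus ha hd (isIncreasingList_neg hξ) hj).decreasesTo_of_eq_neg
    fun n hn => ?_
  rw [show n + 1 - (n + 1 - j) = j by omega]

theorem decreasesTo_leftEnd (ha : 0 < a) (hd : d < 0)
    (hξ : ∀ n, IsIncreasingList (zeroSet (W a b d n)) n (ξ n)) :
    DecreasesTo 1 (fun n => ξ n 1) (leftEnd a b d) := by
  refine (increasesTo_rightEnd ha hd (isIncreasingList_neg hξ)).decreasesTo_of_eq_neg
    fun n _ => ?_
  rw [Nat.add_sub_cancel_left]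

end Enumeration

/-! ### Roots and their limits for the normalized sequence -/

theorem theorem2p2 (a b d : ℝ) (ha : 0 < a) (hb : 0 ≤ b) (hd : d < 0) :
    (∀ n : ℕ, (W a b d n).degree = (n : WithBot ℕ) ∧ DistinctRealRooted (W a b d n)) ∧
    (∀ n : ℕ, Interlaces (zeroSet (W a b d (n + 1))) (zeroSet (W a b d n))) ∧
    ∃ ξ : ℕ → ℕ → ℝ,
      (∀ n : ℕ, IsIncreasingList (zeroSet (W a b d n)) n (ξ n)) ∧
      (∀ j : ℕ, 2 ≤ j →
        DecreasesTo j (fun n => ξ n j) (xDeltaMinus a b d) ∧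
        IncreasesTo j (fun n => ξ n (n + 1 - j)) (xDeltaPlus a b d)) ∧
      ((a ≤ 2 ∧ b ≤ bZero a d) →
        DecreasesTo 1 (fun n => ξ n 1) (xDeltaMinus a b d) ∧
        IncreasesTo 1 (fun n => ξ n n) (xDeltaPlus a b d)) ∧
      ((2 < a ∧ b < bZero a d) →
        XgDefined a b d ∧
        DecreasesTo 1 (fun n => ξ n 1) (xgMinus a b d) ∧
        IncreasesTo 1 (fun n => ξ n n) (xgPlus a b d)) ∧
      ((¬ (a ≤ 2 ∧ b ≤ bZero a d) ∧ ¬ (2 < a ∧ b < bZero a d)) →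
        XgDefined a b d ∧
        DecreasesTo 1 (fun n => ξ n 1) (xDeltaMinus a b d) ∧
        IncreasesTo 1 (fun n => ξ n n) (xgPlus a b d)) := by
  have hs : 0 < √(-d) := Real.sqrt_pos.2 (by linarith)
  choose ξ hξ using exists_isIncreasingList_W ha b hd
  refine ⟨fun n => ⟨?_, (hξ n).distinctRealRooted (W_ne_zero ha b d n) (natDegree_W ha b d n)⟩,
    fun n => ⟨n, ξ (n + 1), ξ n, (hξ (n + 1)).2.symm, (hξ n).2.symm,
      fun i hi => roots_interlace ha hd hξ n i hi.1 hi.2⟩,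
    ξ, hξ, fun j hj => ⟨decreasesTo_xDeltaMinus ha hd hξ hj, increasesTo_xDeltaPlus ha hd hξ hj⟩,
    ?_, ?_, ?_⟩
  · rw [degree_eq_natDegree (W_ne_zero ha b d n), natDegree_W ha b d n]
  all_goals
    have hleft := decreasesTo_leftEnd ha hd hξ
    have hright := increasesTo_rightEnd ha hd hξ
  · rintro ⟨ha2, hb0⟩
    rw [bZero, abs_of_nonpos (by linarith), neg_sub] at hb0
    rw [leftEnd_of_le (by linarith)] at hleft
    rw [rightEnd_of_le hb0] at hright
    exact ⟨hleft, hright⟩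
  · rintro ⟨ha2, hb0⟩
    rw [bZero, abs_of_pos (by linarith)] at hb0
    have hr : (2 - a) * √(-d) < b := by nlinarith
    rw [leftEnd_of_lt (by linarith)] at hleft
    rw [rightEnd_of_lt hr] at hright
    exact ⟨(xgPlus_spec hd hr).1, hleft, hright⟩
  · rintro ⟨h1, h2⟩
    have hlr : -b ≤ (2 - a) * √(-d) ∧ (2 - a) * √(-d) < b := by
      rcases le_or_gt a 2 with ha2 | ha2
      · have hb0 : bZero a d < b := not_le.1 fun h => h1 ⟨ha2, h⟩
        rw [bZero, abs_of_nonpos (by linarith), neg_sub] at hb0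
        exact ⟨by nlinarith, hb0⟩
      · have hb0 : bZero a d ≤ b := not_lt.1 fun h => h2 ⟨ha2, h⟩
        rw [bZero, abs_of_pos (by linarith)] at hb0
        exact ⟨by linarith, by nlinarith⟩
    rw [leftEnd_of_le hlr.1] at hleft
    rw [rightEnd_of_lt hlr.2] at hright
    exact ⟨(xgPlus_spec hd hlr.2).1, hleft, hright⟩
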